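/- Let $\Gamma\subset\mathrm{PSL}_2(\mathbb R)$ be a Fuchsian (i.e. discrete) group acting on the upper half-plane $\mathbb H$ and having a fundamental domain $\mathcal F$ of finite area for the hyperbolic measure $d\mu_{\rm hyp}=y^{-2}dx\,dy$, let $\widetilde\Gamma\subset\mathrm{SL}_2(\mathbb R)$ be the preimage of $\Gamma$ (so $-I\in\widetilde\Gamma$), let $k\in\mathbb R$, and let $V$ be a finite-dimensional complex inner product space with unitary group $U(V)$. For $\gamma\in\mathrm{SL}_2(\mathbb R)$ with lower row $(c,d)$ put $j(\gamma,z)=cz+d$ and $J_{\gamma,k}(z)=\exp(2ik\arg j(\gamma,z))$, with $\arg\in(-\pi,\pi]$; let $w(\gamma_1,\gamma_2)$ be the integer, independent of $z\in\mathbb H$, with $2\pi w(\gamma_1,\gamma_2)=\arg j(\gamma_1,\gamma_2z)+\arg j(\gamma_2,z)-\arg j(\gamma_1\gamma_2,z)$, and put $\omega_k(\gamma_1,\gamma_2)=e^{4\pi ik\,w(\gamma_1,\gamma_2)}$. Let $\chi:\widetilde\Gamma\to U(V)$ be a unitary multiplier system of weight $k$, i.e. $\chi(-I)=e^{-2\pi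 ik}\mathrm{id}_V$ and $\chi(\gamma_1\gamma_2)=\omega_k(\gamma_1,\gamma_2)\chi(\gamma_1)\chi(\gamma_2)$. Put $H_k(z,w)=\bigl(-|z-\overline w|^2/(z-\overline w)^2\bigr)^k$ (principal branch). Let $d_{\rm hyp}$ be the hyperbolic distance and $F(a,b;c;x)$ the Gauss hypergeometric function. For $z,w\in\mathbb H$ consider $$\tilde K_s(z,w)=\frac{\Gamma(s-k)\Gamma(s+k)}{\sqrt{2\pi}\,\Gamma(s)^2}\,S_s(z,w),$$ $$S_s(z,w)=\sum_{\gamma\in\widetilde\Gamma}\chi(\gamma)\cosh(d_{\rm hyp}(z,\gamma w))^{-s}F\bigl(-k,k;s;(1+\cosh d_{\rm hyp}(z,\gamma w))^{-1}\bigr)J_{\gamma,k}(w)H_k(z,\gamma w),$$ with values in $\mathrm{End}(V)$. Let $\mathcal H_k$ be the space of (classes of $\mu_{\rm hyp}$-almost everywhere equal) $\mu_{\rm hyp}$-measurable $f:\mathbb H\to V$ with $f(\gamma z)J_{\gamma,k}(z)^{-1}=\chi(\gamma)f(z)$ for all $\gamma\in\widetilde\Gamma$ and $\int_{\mathcal F}|f|_V^2\,d\mu_{\rm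 hyp}<\infty$. Then: (a) The series $S_s(z,w)$ converges normally for the operator norm of $\mathrm{End}(V)$ in the variables $(z,w;s)$, $\Re(s)>1$: for every compact $C\subset\mathbb H\times\mathbb H$ and every $\sigma>1$, its terms are bounded on $C\times\{\Re(s)\ge\sigma\}$ by the terms of a convergent series of constants; in particular the convergence is uniform there. For all $z,w\in\mathbb H$, $s\mapsto S_s(z,w)$ is holomorphic in $\Re(s)>1$. (b) For all $z,w\in\mathbb H$, $s\mapsto\tilde K_s(z,w)$ is meromorphic in the half-plane $\Re(s)>1$. It is holomorphic there outside the points $s=|k|-n$ with $n$ an integer in $[0,|k|-1]$; every pole in the half-plane is simple and is one of these points, and poles occur there only if $|k|>1$. A point $s_0=|k|-n$ with integer $n\ge0$ and $s_0>1$ is a (simple) pole if and only if $S_{s_0}(z,w)\neq0$. (c) For every $w\in\mathbb H$ and every $s$ with $\Re(s)>\max\{1,|k|\}$, each column of $\tilde K_s(\cdot,w)$, and more generally $z\mapsto\tilde K_s(z,w)v$ for each $v\in V$, belongs to $\mathcal H_k$. -/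

import Mathlib

open UpperHalfPlane MeasureTheory
open scoped MatrixGroups

noncomputable section

namespace GeomKernel

/-- The group `PSL₂(ℝ)`, with the quotient topology. -/
abbrev PSL2R : Type := Matrix.ProjectiveSpecialLinearGroup (Fin 2) ℝ

/-- The centre `{± I}` of `SL₂(ℝ)` acts trivially on the upper half-plane. -/
theorem center_le_ker :
    Subgroup.center SL(2, ℝ) ≤ (MulAction.toPermHom SL(2, ℝ) ℍ).ker := by
  intro g hg
  obtain ⟨r, hr, h⟩ := Matrix.SpecialLinearGroup.mem_center_iff.mp hg
  have hr0 : r ≠ 0 := by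
    rintro rfl
    simp at hr
  have h00 : g 0 0 = r := by rw [← h]; simp
  have h01 : g 0 1 = 0 := by rw [← h]; simp
  have h10 : g 1 0 = 0 := by rw [← h]; simp
  have h11 : g 1 1 = r := by rw [← h]; simp
  rw [MonoidHom.mem_ker]
  ext z
  have hc : (r : ℂ) ≠ 0 := by exact_mod_cast hr0
  simp [UpperHalfPlane.coe_specialLinearGroup_apply, h00, h01, h10, h11, hc]

/-- The action of `PSL₂(ℝ)` on the upper half-plane by fractional linear transformations, obtained
from Mathlib's action of `SL₂(ℝ)`. -/
instance pslAction : MulAction PSL2R ℍ :=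
  MulAction.compHom ℍ
    (QuotientGroup.lift (Subgroup.center SL(2, ℝ)) (MulAction.toPermHom SL(2, ℝ) ℍ) center_le_ker)

theorem psl_mk_smul (g : SL(2, ℝ)) (z : ℍ) :
    (QuotientGroup.mk g : PSL2R) • z = g • z := rfl

/-- The cover of `Γ ⊆ PSL₂(ℝ)` in `SL₂(ℝ)`: all `γ` whose class `[± γ]` lies in `Γ`. -/
def cover (Γ : Subgroup PSL2R) : Subgroup SL(2, ℝ) :=
  Γ.comap (QuotientGroup.mk' (Subgroup.center SL(2, ℝ)))

theorem neg_one_mem_cover (Γ : Subgroup PSL2R) : (-1 : SL(2, ℝ)) ∈ cover Γ := by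
  have h : (-1 : SL(2, ℝ)) ∈ Subgroup.center SL(2, ℝ) := by
    rw [Subgroup.mem_center_iff]
    intro g
    simp
  have h1 : QuotientGroup.mk' (Subgroup.center SL(2, ℝ)) (-1 : SL(2, ℝ)) = 1 :=
    (QuotientGroup.eq_one_iff _).mpr h
  rw [cover, Subgroup.mem_comap, h1]
  exact Γ.one_mem

/-- `j(γ, z) = c z + d`, where `(c, d)` is the lower row of `γ`. -/
def j (γ : SL(2, ℝ)) (z : ℍ) : ℂ := (γ 1 0 : ℂ) * (z : ℂ) + (γ 1 1 : ℂ)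

/-- `J_{γ,k}(z) = exp(2 i k arg (c z + d))`, with `arg` in `(-π, π]`. -/
def J (k : ℝ) (γ : SL(2, ℝ)) (z : ℍ) : ℂ :=
  Complex.exp (2 * Complex.I * k * ((j γ z).arg : ℂ))

/-- The number `w(γ₁, γ₂)` with
`2π w(γ₁, γ₂) = arg j(γ₁, γ₂ z) + arg j(γ₂, z) - arg j(γ₁ γ₂, z)`. The right-hand side is an integer
multiple of `2π` which does not depend on `z ∈ ℍ`, so it is evaluated at `z = i`. -/
def wFactor (γ₁ γ₂ : SL(2, ℝ)) : ℝ :=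
  ((j γ₁ (γ₂ • UpperHalfPlane.I)).arg + (j γ₂ UpperHalfPlane.I).arg
    - (j (γ₁ * γ₂) UpperHalfPlane.I).arg) / (2 * Real.pi)

/-- The factor system `ω_k(γ₁, γ₂) = exp(4 π i k w(γ₁, γ₂))` of weight `k`. -/
def omega (k : ℝ) (γ₁ γ₂ : SL(2, ℝ)) : ℂ :=
  Complex.exp (4 * Real.pi * Complex.I * k * wFactor γ₁ γ₂)

/-- The principal-branch power `H_k(z, w) = (- |z - w̄|² / (z - w̄)²) ^ k`. -/
def H (k : ℝ) (z w : ℍ) : ℂ :=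
  (-((‖(z : ℂ) - (starRingEnd ℂ) (w : ℂ)‖ : ℂ) ^ 2 /
    ((z : ℂ) - (starRingEnd ℂ) (w : ℂ)) ^ 2)) ^ (k : ℂ)

variable {V : Type*} [NormedAddCommGroup V] [InnerProductSpace ℂ V]

/-- `χ : Γ̃ → U(V)` is a unitary multiplier system of weight `k` on the cover `Γ̃` of `Γ`. -/
structure IsMultiplierSystem (Γ : Subgroup PSL2R) (k : ℝ) (χ : cover Γ → (V ≃ₗᵢ[ℂ] V)) :
    Prop where
  map_neg_one : ∀ v : V, χ ⟨-1, neg_one_mem_cover Γ⟩ v =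
    Complex.exp (-(2 * Real.pi * Complex.I * k)) • v
  map_mul : ∀ (γ₁ γ₂ : cover Γ) (v : V), χ (γ₁ * γ₂) v = omega k γ₁ γ₂ • χ γ₁ (χ γ₂ v)

/-- The unitary operator `χ(γ)` as an element of `End(V)`, which carries the operator norm. -/
def toEnd (u : V ≃ₗᵢ[ℂ] V) : V →L[ℂ] V := (u.toContinuousLinearEquiv : V →L[ℂ] V)

/-- The summand
`χ(γ) cosh(d(z,γw))^{-s} F(-k, k; s; (1 + cosh d(z,γw))⁻¹) J_{γ,k}(w) H_k(z, γw)`. -/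
def term (Γ : Subgroup PSL2R) (k : ℝ) (χ : cover Γ → (V ≃ₗᵢ[ℂ] V)) (γ : cover Γ)
    (s : ℂ) (z w : ℍ) : V →L[ℂ] V :=
  ((Real.cosh (dist z ((γ : SL(2, ℝ)) • w)) : ℂ) ^ (-s)
    * ordinaryHypergeometric (-(k : ℂ)) (k : ℂ) s
        (((1 + Real.cosh (dist z ((γ : SL(2, ℝ)) • w)))⁻¹ : ℝ) : ℂ)
    * J k (γ : SL(2, ℝ)) w * H k z ((γ : SL(2, ℝ)) • w)) • toEnd (χ γ)

/-- The sum over `Γ̃` in the definition of the geometric automorphic kernel. -/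
def kernelSum (Γ : Subgroup PSL2R) (k : ℝ) (χ : cover Γ → (V ≃ₗᵢ[ℂ] V))
    (s : ℂ) (z w : ℍ) : V →L[ℂ] V :=
  ∑' γ : cover Γ, term Γ k χ γ s z w

/-- The factor `Γ(s - k) Γ(s + k) / (√(2π) Γ(s)²)`. -/
def gammaFactor (k : ℝ) (s : ℂ) : ℂ :=
  Complex.Gamma (s - k) * Complex.Gamma (s + k) /
    ((Real.sqrt (2 * Real.pi) : ℂ) * Complex.Gamma s ^ 2)

/-- The geometric automorphic kernel `K̃_s(z, w)`. -/
def kernel (Γ : Subgroup PSL2R) (k : ℝ) (χ : cover Γ → (V ≃ₗᵢ[ℂ] V))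
    (s : ℂ) (z w : ℍ) : V →L[ℂ] V :=
  gammaFactor k s • kernelSum Γ k χ s z w

/-- `f : ℍ → V` is (a representative of) an element of the Hilbert space `ℋ_k`: it is measurable
for the hyperbolic measure `dx dy / y²` (the volume on `ℍ`), satisfies
`f(γz) J_{γ,k}(z)⁻¹ = χ(γ) f(z)` for all `γ ∈ Γ̃`, and is square-integrable on the fundamental
domain `F`. -/
structure MemHk (Γ : Subgroup PSL2R) (k : ℝ) (χ : cover Γ → (V ≃ₗᵢ[ℂ] V)) (F : Set ℍ)
    (f : ℍ → V) : Prop where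
  aestronglyMeasurable : AEStronglyMeasurable f (volume : Measure ℍ)
  slash_eq : ∀ (γ : cover Γ) (z : ℍ),
    (J k (γ : SL(2, ℝ)) z)⁻¹ • f ((γ : SL(2, ℝ)) • z) = χ γ (f z)
  square_integrable : ∫⁻ z in F, ‖f z‖ₑ ^ 2 ∂(volume : Measure ℍ) < ⊤

end GeomKernel

end

noncomputable section

namespace GeomKernel

/-! ### The action of `PSL₂(ℝ)` -/

/-! The factors `χ(γ)`, `J` and `H` are isometric or of modulus one, and `F(-k,k;s;x)` is bounded
for `Re s ≥ 1`, `|x| ≤ 1/2`, because `|(s)_n| ≥ n!` there. Hence each term is at most a constant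
depending on `k` times `cosh(d(z,γw))^(-Re s)` (`norm_term_le`), and (a) reduces to the convergence
of `∑ cosh(d(z,γw))^(-σ)` for `σ > 1`. The function `cosh(d(i,·))^(-σ)` is integrable on `ℍ`;
unfolding its integral over `F` makes the orbit sum finite at one point (`exists_tsum_cosh_lt_top`),
and the triangle inequality carries this to all pairs of points, uniformly on compacta. Holomorphy
is then Weierstrass' theorem.

For (b), the only factor with poles in `Re s > 1` is `Γ(s - |k|)`; its poles are simple and the
other Gamma factors are analytic without zeros. So at `|k| - n` the kernel has the order of the
analytic function `S_s` minus one.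

For (c), the cocycle relation `omega_mul_J` and the transformation law `H_smul` give automorphy
after reindexing the sum (`kernelSum_smul`). For fixed `w` the kernel is bounded in `z` on all of
`ℍ` (`exists_tsum_cosh_le`, a packing argument), hence square-integrable on a domain of finite area.
-/

theorem dist_psl_smul (g : PSL2R) (z w : ℍ) : dist (g • z) (g • w) = dist z w := by
  induction g using QuotientGroup.induction_on with
  | H g => simp only [psl_mk_smul, dist_smul]

instance : ContinuousConstSMul SL(2, ℝ) ℍ :=
  ⟨fun g => (isometry_smul ℍ g).continuous⟩

instance : ContinuousConstSMul PSL2R ℍ :=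
  ⟨fun g => (Isometry.of_dist_eq fun z w => dist_psl_smul g z w).continuous⟩

instance : SMulInvariantMeasure SL(2, ℝ) ℍ volume :=
  ⟨fun g _ hs => SMulInvariantMeasure.measure_preimage_smul
    (Matrix.SpecialLinearGroup.toGL g) hs⟩

instance : SMulInvariantMeasure PSL2R ℍ volume := by
  refine ⟨fun g s hs => ?_⟩
  induction g using QuotientGroup.induction_on with
  | H g => exact SMulInvariantMeasure.measure_preimage_smul g hs

instance (Γ : Subgroup PSL2R) : ContinuousConstSMul Γ ℍ :=
  ⟨fun g => continuous_const_smul (g : PSL2R)⟩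

/-- Countability is what allows unfolding over a fundamental domain and exchanging sums with
integrals. -/
theorem countable_of_discreteTopology (Γ : Subgroup PSL2R) [DiscreteTopology Γ] :
    Countable Γ := by
  have : SecondCountableTopology (Matrix (Fin 2) (Fin 2) ℝ) :=
    inferInstanceAs (SecondCountableTopology (Fin 2 → Fin 2 → ℝ))
  have : SecondCountableTopology SL(2, ℝ) :=
    TopologicalSpace.Subtype.secondCountableTopology
      {A : Matrix (Fin 2) (Fin 2) ℝ | A.det = 1}
  have : SecondCountableTopology PSL2R := QuotientGroup.instSecondCountableTopology _
  exact countable_of_Lindelof_of_discrete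

/-- The density `y⁻²` vanishes nowhere, so a null open set would be Lebesgue-null in `ℂ`. This makes
balls non-null, and `F` too. -/
instance : (volume : Measure ℍ).IsOpenPosMeasure := by
  refine ⟨fun U hU hne h0 => ?_⟩
  have hm : Measurable fun z : ℍ =>
      (((1 / NNReal.mk z.im z.im_pos.le : NNReal) ^ 2 : NNReal) : ENNReal) := by
    refine measurable_coe_nnreal_ennreal.comp ((measurable_const.div ?_).pow_const 2)
    exact (continuous_im.subtype_mk _).measurable
  rw [volume_def, withDensity_apply_eq_zero hm] at h0
  have hset : {z : ℍ | (((1 / NNReal.mk z.im z.im_pos.le : NNReal) ^ 2 : NNReal) : ENNReal) ≠ 0}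
      ∩ U = U := by
    refine Set.inter_eq_right.mpr fun z _ => ?_
    have h : NNReal.mk z.im z.im_pos.le ≠ 0 := fun h => z.im_ne_zero (congrArg NNReal.toReal h)
    exact ENNReal.coe_ne_zero.mpr (pow_ne_zero 2 (div_ne_zero one_ne_zero h))
  rw [hset, measurableEmbedding_coe.comap_apply] at h0
  exact ((isOpenEmbedding_coe.isOpenMap U hU).measure_pos volume (hne.image _)).ne' h0

/-! ### The integral of `cosh(d(w, z)) ^ (-σ)` over the upper half-plane -/

theorem cosh_dist_I (z : ℍ) :
    Real.cosh (dist I z) = (1 + z.re ^ 2 + z.im ^ 2) / (2 * z.im) := by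
  have hy := z.im_pos
  rw [cosh_dist, Complex.dist_eq, Complex.sq_norm, Complex.normSq_apply]
  simp only [Complex.sub_re, Complex.sub_im, coe_I, Complex.I_re, Complex.I_im, coe_re, coe_im,
    I_im]
  field_simp
  ring

/-- Compare with `y^(σ-2)` on `(0,1]`, integrable as `σ > 1`, and with `y^(-2)` beyond. -/
theorem integrableOn_rpow_mul_one_add_sq {σ : ℝ} (hσ : 1 < σ) :
    IntegrableOn (fun y : ℝ => y ^ (σ - 2) * (1 + y ^ 2) ^ (-σ / 2)) (Set.Ioi 0) := by
  have hm : Measurable (fun y : ℝ => y ^ (σ - 2) * (1 + y ^ 2) ^ (-σ / 2)) := by fun_prop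
  rw [← Set.Ioc_union_Ioi_eq_Ioi (zero_le_one' ℝ)]
  refine IntegrableOn.union ?_ ?_
  · have h1 : IntegrableOn (fun y : ℝ => y ^ (σ - 2)) (Set.Ioc 0 1) :=
      (intervalIntegrable_iff_integrableOn_Ioc_of_le zero_le_one).mp
        (intervalIntegral.intervalIntegrable_rpow' (by linarith))
    refine Integrable.mono' h1 hm.aestronglyMeasurable ?_
    refine (ae_restrict_iff' measurableSet_Ioc).mpr (.of_forall fun y hy => ?_)
    have hy0 : 0 < y := hy.1
    rw [Real.norm_of_nonneg (by positivity)]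
    refine mul_le_of_le_one_right (by positivity) ?_
    exact Real.rpow_le_one_of_one_le_of_nonpos (by nlinarith [sq_nonneg y]) (by linarith)
  · have h1 : IntegrableOn (fun y : ℝ => y ^ (-2 : ℝ)) (Set.Ioi 1) :=
      integrableOn_Ioi_rpow_of_lt (by norm_num) one_pos
    refine Integrable.mono' h1 hm.aestronglyMeasurable ?_
    refine (ae_restrict_iff' measurableSet_Ioi).mpr (.of_forall fun y hy => ?_)
    have hy0 : 0 < y := zero_lt_one.trans hy
    rw [Real.norm_of_nonneg (by positivity)]
    have h2 : (1 + y ^ 2) ^ (-σ / 2) ≤ (y ^ 2) ^ (-σ / 2) :=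
      Real.rpow_le_rpow_of_nonpos (by positivity) (by linarith) (by linarith)
    have h3 : (y ^ 2) ^ (-σ / 2) = y ^ (-σ) := by
      rw [← Real.rpow_natCast, ← Real.rpow_mul hy0.le]
      congr 1
      push_cast
      ring
    calc y ^ (σ - 2) * (1 + y ^ 2) ^ (-σ / 2) ≤ y ^ (σ - 2) * y ^ (-σ) := by
          rw [← h3]; gcongr
      _ = y ^ (-2 : ℝ) := by
          rw [← Real.rpow_add hy0]
          congr 1
          ring

/-- Splitting the exponent `-σ` into two halves and dropping `y²` in one, `x²` in the other,
separates the variables. -/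
theorem cosh_dist_I_rpow_le {σ : ℝ} (hσ : 1 < σ) (z : ℍ) :
    (1 / z.im) ^ 2 * Real.cosh (dist I z) ^ (-σ) ≤
      2 ^ σ * ((1 + z.re ^ 2) ^ (-σ / 2) *
        (z.im ^ (σ - 2) * (1 + z.im ^ 2) ^ (-σ / 2))) := by
  have hy := z.im_pos
  have hA : 0 < 1 + z.re ^ 2 + z.im ^ 2 := by positivity
  have h1 : (1 + z.re ^ 2 + z.im ^ 2) ^ (-σ / 2) ≤ (1 + z.re ^ 2) ^ (-σ / 2) :=
    Real.rpow_le_rpow_of_nonpos (by positivity) (by nlinarith) (by linarith)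
  have h2 : (1 + z.re ^ 2 + z.im ^ 2) ^ (-σ / 2) ≤ (1 + z.im ^ 2) ^ (-σ / 2) :=
    Real.rpow_le_rpow_of_nonpos (by positivity) (by nlinarith [sq_nonneg z.re]) (by linarith)
  have h3 : (1 + z.re ^ 2 + z.im ^ 2) ^ (-σ) =
      (1 + z.re ^ 2 + z.im ^ 2) ^ (-σ / 2) * (1 + z.re ^ 2 + z.im ^ 2) ^ (-σ / 2) := by
    rw [← Real.rpow_add hA]
    congr 1
    ring
  have h4 : (1 / z.im) ^ 2 * Real.cosh (dist I z) ^ (-σ) =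
      2 ^ σ * (z.im ^ (σ - 2) * (1 + z.re ^ 2 + z.im ^ 2) ^ (-σ)) := by
    rw [cosh_dist_I, Real.div_rpow hA.le (by positivity), Real.mul_rpow zero_le_two hy.le,
      Real.rpow_neg zero_le_two, Real.rpow_neg hy.le, Real.rpow_sub hy]
    have : z.im ^ (2 : ℝ) = z.im ^ 2 := by norm_cast
    rw [this]
    have := (Real.rpow_pos_of_pos hy σ).ne'
    have := (Real.rpow_pos_of_pos zero_lt_two σ).ne'
    field_simp
  rw [h4, h3]
  calc _ ≤ 2 ^ σ * (z.im ^ (σ - 2) * ((1 + z.re ^ 2) ^ (-σ / 2) * (1 + z.im ^ 2) ^ (-σ / 2))) := by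
        gcongr
    _ = _ := by ring

/-- No measurability of `f` is needed: the density is measurable and finite, and the changes of
variables are measurable embeddings. -/
theorem lintegral_eq_lintegral_prod (f : ℝ → ℝ → ENNReal) :
    ∫⁻ z : ℍ, f z.re z.im =
      ∫⁻ p : ℝ × ℝ, (Set.Ioi (0 : ℝ)).indicator
        (fun y => ENNReal.ofReal ((1 / y) ^ 2) * f p.1 y) p.2 := by
  have hm : Measurable fun z : ℍ => (1 / NNReal.mk z.im z.im_pos.le : NNReal) ^ 2 := by
    refine (measurable_const.div ?_).pow_const 2
    exact (continuous_im.subtype_mk _).measurable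
  have hpres : MeasurePreserving UpperHalfPlane.coe (volume.comap UpperHalfPlane.coe)
      (volume.restrict (.range UpperHalfPlane.coe)) :=
    ⟨measurable_coe, by rw [measurableEmbedding_coe.map_comap]⟩
  have h1 : ∫⁻ z : ℍ, f z.re z.im =
      ∫⁻ z : ℂ in .range UpperHalfPlane.coe, ENNReal.ofReal ((1 / z.im) ^ 2) * f z.re z.im := by
    rw [volume_def, lintegral_withDensity_eq_lintegral_mul_non_measurable _ (by fun_prop)
      (.of_forall fun _ => ENNReal.coe_lt_top),
      ← hpres.lintegral_comp_emb measurableEmbedding_coe]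
    refine lintegral_congr fun z => ?_
    simp only [Pi.mul_apply, coe_re, coe_im]
    congr 1
    rw [← ENNReal.ofReal_coe_nnreal]
    simp
  have h2 : Set.range UpperHalfPlane.coe = {z : ℂ | 0 < z.im} := by
    ext z
    exact ⟨by rintro ⟨w, rfl⟩; exact w.im_pos, fun h => ⟨⟨z, h⟩, rfl⟩⟩
  rw [h1, h2, ← lintegral_indicator (measurableSet_lt measurable_const Complex.measurable_im),
    Complex.volume_preserving_equiv_real_prod.symm.lintegral_map_equiv]
  refine lintegral_congr fun p => ?_
  simp [Set.indicator]

theorem lintegral_cosh_dist_I_lt_top {σ : ℝ} (hσ : 1 < σ) :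
    ∫⁻ z : ℍ, ENNReal.ofReal (Real.cosh (dist I z) ^ (-σ)) < ⊤ := by
  have e : ∀ z : ℍ, ENNReal.ofReal (Real.cosh (dist I z) ^ (-σ)) =
      (fun x y : ℝ => ENNReal.ofReal (((1 + x ^ 2 + y ^ 2) / (2 * y)) ^ (-σ))) z.re z.im :=
    fun z => by rw [cosh_dist_I]
  simp_rw [e]
  rw [lintegral_eq_lintegral_prod
    fun x y : ℝ => ENNReal.ofReal (((1 + x ^ 2 + y ^ 2) / (2 * y)) ^ (-σ))]
  set g : ℝ → ENNReal := (Set.Ioi (0 : ℝ)).indicator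
    fun y => ENNReal.ofReal (y ^ (σ - 2) * (1 + y ^ 2) ^ (-σ / 2))
  set h : ℝ → ENNReal := fun x => ENNReal.ofReal (2 ^ σ * (1 + x ^ 2) ^ (-σ / 2))
  have hg : Measurable g := Measurable.indicator (by fun_prop) measurableSet_Ioi
  have hh : Measurable h := by fun_prop
  have hle : ∀ p : ℝ × ℝ, (Set.Ioi (0 : ℝ)).indicator
      (fun y => ENNReal.ofReal ((1 / y) ^ 2) *
        ENNReal.ofReal (((1 + p.1 ^ 2 + y ^ 2) / (2 * y)) ^ (-σ))) p.2 ≤ h p.1 * g p.2 := by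
    rintro ⟨x, y⟩
    by_cases hy : 0 < y
    · simp only [g, h, Set.indicator, Set.mem_Ioi, hy, if_true]
      rw [← ENNReal.ofReal_mul (by positivity), ← ENNReal.ofReal_mul (by positivity)]
      refine ENNReal.ofReal_le_ofReal ?_
      have := cosh_dist_I_rpow_le hσ ⟨⟨x, y⟩, hy⟩
      rw [cosh_dist_I] at this
      rw [mul_assoc (2 ^ σ : ℝ)]
      exact this
    · simp [Set.indicator, hy]
  refine (lintegral_mono hle).trans_lt ?_
  rw [Measure.volume_eq_prod, lintegral_prod_mul hh.aemeasurable hg.aemeasurable]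
  refine ENNReal.mul_lt_top ?_ ?_
  · have h1 : Integrable (fun x : ℝ => (1 + ‖x‖ ^ 2) ^ (-σ / 2)) :=
      integrable_rpow_neg_one_add_norm_sq (by simpa using hσ)
    simp only [Real.norm_eq_abs, sq_abs] at h1
    exact (h1.const_mul (2 ^ σ)).lintegral_lt_top
  · rw [lintegral_indicator measurableSet_Ioi]
    exact (integrableOn_rpow_mul_one_add_sq hσ).lintegral_lt_top

theorem lintegral_cosh_dist_eq (σ : ℝ) (w : ℍ) :
    ∫⁻ z : ℍ, ENNReal.ofReal (Real.cosh (dist w z) ^ (-σ)) =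
      ∫⁻ z : ℍ, ENNReal.ofReal (Real.cosh (dist I z) ^ (-σ)) := by
  rw [← (measurePreserving_smul w.toSL2R (volume : Measure ℍ)).lintegral_comp_emb
    (measurableEmbedding_const_smul _)]
  refine lintegral_congr fun z => ?_
  have h : dist w (w.toSL2R • z) = dist I z := by
    simpa using dist_smul w.toSL2R I z
  rw [h]

/-! ### Comparison of `cosh` at nearby distances -/

/-- This rests on `cosh d' ≤ e^(d') ≤ e^d e^r ≤ 2 e^r cosh d`. It lets the base points of an orbit
sum move at the cost of a constant factor. -/
theorem cosh_rpow_neg_le {σ d d' r : ℝ} (hσ : 0 ≤ σ) (hd : 0 ≤ d') (h : d' ≤ d + r) :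
    Real.cosh d ^ (-σ) ≤ (2 * Real.exp r) ^ σ * Real.cosh d' ^ (-σ) := by
  have h1 : Real.cosh d' ≤ 2 * Real.exp r * Real.cosh d := by
    have e1 : Real.cosh d' ≤ Real.exp d' := by
      rw [Real.cosh_eq]
      have : Real.exp (-d') ≤ Real.exp d' := Real.exp_le_exp.mpr (by linarith)
      linarith
    have e2 : Real.exp d ≤ 2 * Real.cosh d := by
      rw [Real.cosh_eq]
      have := Real.exp_pos (-d)
      linarith
    have e3 : Real.exp d' ≤ Real.exp d * Real.exp r := by
      rw [← Real.exp_add]; exact Real.exp_le_exp.mpr h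
    nlinarith [Real.exp_pos r]
  have hc := Real.cosh_pos d
  have hc' := Real.cosh_pos d'
  have hr := Real.exp_pos r
  have h2 : (2 * Real.exp r * Real.cosh d) ^ (-σ) ≤ Real.cosh d' ^ (-σ) :=
    Real.rpow_le_rpow_of_nonpos hc' h1 (by linarith)
  rw [Real.mul_rpow (by positivity) hc.le, Real.rpow_neg (by positivity)] at h2
  have h3 : 0 < (2 * Real.exp r) ^ σ := by positivity
  calc Real.cosh d ^ (-σ)
      = (2 * Real.exp r) ^ σ * (((2 * Real.exp r) ^ σ)⁻¹ * Real.cosh d ^ (-σ)) := by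
        field_simp
    _ ≤ _ := by gcongr

/-! ### Summability over the group -/

/-- The integral over `ℍ` unfolds to the integral over `F` of the orbit sum; being finite, it forces
a finite sum almost everywhere on `F`, and `F` is not null. -/
theorem exists_tsum_cosh_lt_top (Γ : Subgroup PSL2R) [DiscreteTopology Γ] {F : Set ℍ}
    (hF : IsFundamentalDomain Γ F (volume : Measure ℍ)) {σ : ℝ} (hσ : 1 < σ) :
    ∃ x : ℍ, ∑' g : Γ, ENNReal.ofReal (Real.cosh (dist I (g • x)) ^ (-σ)) < ⊤ := by
  have := countable_of_discreteTopology Γ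
  have hm : ∀ g : Γ, Measurable fun x : ℍ =>
      ENNReal.ofReal (Real.cosh (dist I (g • x)) ^ (-σ)) := fun g => by
    have : Continuous fun x : ℍ => Real.cosh (dist I (g • x)) := by fun_prop
    have := this.measurable
    fun_prop
  have h1 := lintegral_cosh_dist_I_lt_top hσ
  rw [hF.lintegral_eq_tsum'', ← lintegral_tsum fun g => (hm g).aemeasurable] at h1
  have h2 := ae_lt_top (Measurable.tsum hm) h1.ne
  have h3 : volume F ≠ 0 := hF.measure_ne_zero (NeZero.ne _)
  have : NeZero ((volume : Measure ℍ).restrict F) := ⟨by simpa using h3⟩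
  exact h2.exists

/-- Matrices in the cover are determined by their class together with the sign of their lower
row. -/
theorem cover_ext {Γ : Subgroup PSL2R} {γ δ : cover Γ}
    (h : (QuotientGroup.mk (γ : SL(2, ℝ)) : PSL2R) = QuotientGroup.mk (δ : SL(2, ℝ)))
    (hs : (0 < (γ : SL(2, ℝ)) 1 0 ∨ (γ : SL(2, ℝ)) 1 0 = 0 ∧ 0 < (γ : SL(2, ℝ)) 1 1) ↔
      (0 < (δ : SL(2, ℝ)) 1 0 ∨ (δ : SL(2, ℝ)) 1 0 = 0 ∧ 0 < (δ : SL(2, ℝ)) 1 1)) : γ = δ := by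
  obtain ⟨γ, hγ⟩ := γ
  obtain ⟨δ, hδ⟩ := δ
  simp only at h hs
  rw [QuotientGroup.eq, Matrix.SpecialLinearGroup.mem_center_iff] at h
  obtain ⟨r, hr, h⟩ := h
  have hr2 : r ^ 2 = 1 := by simpa using hr
  have hδγ : (δ : Matrix (Fin 2) (Fin 2) ℝ) = r • (γ : Matrix (Fin 2) (Fin 2) ℝ) := by
    have e : δ = γ * (γ⁻¹ * δ) := by group
    rw [e, Matrix.SpecialLinearGroup.coe_mul, ← h, Matrix.scalar_apply,
      ← Matrix.smul_one_eq_diagonal, Matrix.mul_smul, mul_one]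
  rcases (sq_eq_sq_iff_eq_or_eq_neg.mp (hr2.trans (one_pow 2).symm)) with rfl | rfl
  · exact Subtype.ext (Subtype.ext (by simpa using hδγ.symm))
  -- If `δ = -γ`, the lower rows are opposite and nonzero, so exactly one of them is positive in the
  -- lexicographic sense.
  · exfalso
    have h10 : δ 1 0 = -γ 1 0 := by simpa using congrFun (congrFun hδγ 1) 0
    have h11 : δ 1 1 = -γ 1 1 := by simpa using congrFun (congrFun hδγ 1) 1
    rw [h10, h11] at hs
    have hdet := γ.det_coe
    rw [Matrix.det_fin_two] at hdet
    rcases lt_trichotomy (γ 1 0) 0 with hc | hc | hc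
    · have := hs.mpr (.inl (by linarith))
      rcases this with h | h <;> linarith [h]
    · rcases lt_trichotomy (γ 1 1) 0 with hd | hd | hd
      · rcases hs.mpr (.inr ⟨by linarith, by linarith⟩) with h | h
        · linarith
        · linarith [h.2]
      · rw [hc, hd] at hdet
        simp at hdet
      · rcases hs.mp (.inr ⟨hc, hd⟩) with h | h
        · linarith
        · linarith [h.2]
    · rcases hs.mp (.inl hc) with h | h
      · linarith
      · linarith [h.1]

open Classical in
/-- The class of a matrix in the cover together with the sign of its lower row. -/
def coverCode (Γ : Subgroup PSL2R) (γ : cover Γ) : Γ × Bool :=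
  (⟨QuotientGroup.mk (γ : SL(2, ℝ)), γ.2⟩,
    decide (0 < (γ : SL(2, ℝ)) 1 0 ∨ (γ : SL(2, ℝ)) 1 0 = 0 ∧ 0 < (γ : SL(2, ℝ)) 1 1))

/-- Sums over the cover are thereby dominated by sums over two copies of `Γ`. -/
theorem coverCode_injective (Γ : Subgroup PSL2R) : Function.Injective (coverCode Γ) := by
  intro γ δ h
  rw [coverCode, coverCode, Prod.mk.injEq, decide_eq_decide] at h
  exact cover_ext (congrArg Subtype.val h.1) h.2

theorem countable_cover (Γ : Subgroup PSL2R) [DiscreteTopology Γ] : Countable (cover Γ) :=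
  have := countable_of_discreteTopology Γ
  (coverCode_injective Γ).countable

theorem summable_cosh (Γ : Subgroup PSL2R) [DiscreteTopology Γ] {F : Set ℍ}
    (hF : IsFundamentalDomain Γ F (volume : Measure ℍ)) {σ : ℝ} (hσ : 1 < σ) (z w : ℍ) :
    Summable fun γ : cover Γ => Real.cosh (dist z ((γ : SL(2, ℝ)) • w)) ^ (-σ) := by
  obtain ⟨x, hx⟩ := exists_tsum_cosh_lt_top Γ hF hσ
  have h1 : Summable fun g : Γ => Real.cosh (dist I (g • x)) ^ (-σ) := by
    refine (ENNReal.summable_toReal hx.ne).congr fun g => ?_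
    exact ENNReal.toReal_ofReal (by positivity)
  have h2 : Summable fun p : Γ × Bool => Real.cosh (dist I (p.1 • x)) ^ (-σ) := by
    rw [summable_prod_of_nonneg fun p => by positivity]
    exact ⟨fun g => .of_finite, by simpa using h1.mul_left 2⟩
  have h3 := h2.comp_injective (coverCode_injective Γ)
  refine .of_nonneg_of_le (fun γ => by positivity) (fun γ => ?_)
    (h3.mul_left ((2 * Real.exp (dist I z + dist w x)) ^ σ))
  refine cosh_rpow_neg_le (by linarith) dist_nonneg ?_
  have e1 := dist_triangle4 I z ((γ : SL(2, ℝ)) • w) ((γ : SL(2, ℝ)) • x)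
  rw [dist_smul] at e1
  change dist I ((γ : SL(2, ℝ)) • x) ≤ _
  linarith

/-- For fixed `w`, the sum of `cosh(d(z, γw)) ^ (-σ)` is bounded uniformly in `z`. -/
theorem exists_tsum_cosh_le (Γ : Subgroup PSL2R) [DiscreteTopology Γ] {F : Set ℍ}
    (hF : IsFundamentalDomain Γ F (volume : Measure ℍ)) {σ : ℝ} (hσ : 1 < σ) (w : ℍ) :
    ∃ B : ℝ, ∀ z : ℍ, ∑' γ : cover Γ, Real.cosh (dist z ((γ : SL(2, ℝ)) • w)) ^ (-σ) ≤ B := by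
  have := countable_cover Γ
  set a : ℍ → ℍ → ENNReal := fun z u => ENNReal.ofReal (Real.cosh (dist z u) ^ (-σ))
  set N : ENNReal := ∑' γ : cover Γ, a w ((γ : SL(2, ℝ)) • w)
  have ha : ∀ z, Continuous (a z) := fun z => by
    refine ENNReal.continuous_ofReal.comp ?_
    exact (Real.continuous_cosh.comp (by fun_prop)).rpow_const
      fun u => .inl (Real.cosh_pos _).ne'
  have hN : N < ⊤ := (summable_cosh Γ hF hσ w w).tsum_ofReal_lt_top
  have hball : ∀ γ : cover Γ, volume (Metric.ball ((γ : SL(2, ℝ)) • w) 1) =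
      volume (Metric.ball w 1) := fun γ => by
    rw [← Metric.smul_ball, measure_smul]
  set K : ENNReal := ENNReal.ofReal (Real.cosh 2 ^ σ)
  -- Bounded overlap: if `u` lies in the ball about `γ₀w`, every other ball `γ₀δ` containing `u` has
  -- `d(w,δw) ≤ 2`. Each such `δ` contributes at least `cosh(2)^(-σ)` to `N`, so there are at most
  -- `K * N` of them.
  have hmult : ∀ u : ℍ, ∑' γ : cover Γ,
      (Metric.ball ((γ : SL(2, ℝ)) • w) 1).indicator (1 : ℍ → ENNReal) u ≤ K * N := by
    intro u
    by_cases hu : ∃ γ₀ : cover Γ, u ∈ Metric.ball ((γ₀ : SL(2, ℝ)) • w) 1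
    · obtain ⟨γ₀, hγ₀⟩ := hu
      rw [← (Equiv.mulLeft γ₀).tsum_eq, ← ENNReal.tsum_mul_left]
      refine ENNReal.tsum_le_tsum fun δ => ?_
      by_cases hδ : u ∈ Metric.ball (((γ₀ * δ : cover Γ) : SL(2, ℝ)) • w) 1
      · rw [Equiv.coe_mulLeft, Set.indicator_of_mem hδ]
        have hd : dist w ((δ : SL(2, ℝ)) • w) ≤ 2 := by
          rw [Metric.mem_ball] at hδ hγ₀
          rw [← dist_smul (γ₀ : SL(2, ℝ)), smul_smul]
          have := dist_triangle_left ((γ₀ : SL(2, ℝ)) • w)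
            (((γ₀ : SL(2, ℝ)) * (δ : SL(2, ℝ))) • w) u
          have e : ((γ₀ * δ : cover Γ) : SL(2, ℝ)) = (γ₀ : SL(2, ℝ)) * δ := rfl
          rw [e] at hδ
          linarith
        simp only [Pi.one_apply, K, a]
        rw [← ENNReal.ofReal_mul (by positivity), ← ENNReal.ofReal_one]
        refine ENNReal.ofReal_le_ofReal ?_
        rw [Real.rpow_neg (Real.cosh_pos _).le, ← div_eq_mul_inv, one_le_div (by positivity)]
        refine Real.rpow_le_rpow (Real.cosh_pos _).le ?_ (by linarith)
        rw [Real.cosh_le_cosh, abs_of_nonneg dist_nonneg]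
        simpa using hd
      · rw [Equiv.coe_mulLeft, Set.indicator_of_notMem hδ]
        exact bot_le
    · push Not at hu
      simp [Set.indicator_of_notMem (hu _)]
  set C : ENNReal := ENNReal.ofReal ((2 * Real.exp 1) ^ σ)
  -- On a ball of radius 1 the value at the centre is at most `C` times the value at any point;
  -- integrate over the ball.
  have hlocal : ∀ (z : ℍ) (γ : cover Γ), a z ((γ : SL(2, ℝ)) • w) * volume (Metric.ball w 1) ≤
      C * ∫⁻ u, (Metric.ball ((γ : SL(2, ℝ)) • w) 1).indicator 1 u * a z u := by
    intro z γ
    rw [← hball γ, ← setLIntegral_const, ← lintegral_const_mul _ (by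
      refine Measurable.mul ?_ (ha z).measurable
      exact measurable_one.indicator Metric.isOpen_ball.measurableSet),
      ← lintegral_indicator Metric.isOpen_ball.measurableSet]
    refine lintegral_mono fun u => ?_
    by_cases hu : u ∈ Metric.ball ((γ : SL(2, ℝ)) • w) 1
    · simp only [Set.indicator_of_mem hu, Pi.one_apply, one_mul, C, a]
      rw [← ENNReal.ofReal_mul (by positivity)]
      refine ENNReal.ofReal_le_ofReal (cosh_rpow_neg_le (by linarith) dist_nonneg ?_)
      have := dist_triangle_right z u ((γ : SL(2, ℝ)) • w)
      rw [Metric.mem_ball] at hu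
      linarith
    · simp [Set.indicator_of_notMem hu]
  set T : ENNReal := ∫⁻ u : ℍ, a I u
  have hT : T < ⊤ := lintegral_cosh_dist_I_lt_top hσ
  have hm0 : volume (Metric.ball w 1) ≠ 0 := (Metric.measure_ball_pos _ _ one_pos).ne'
  have hm1 : volume (Metric.ball w 1) ≠ ⊤ := measure_ball_lt_top.ne
  have hsum : ∀ z : ℍ, ∑' γ : cover Γ, a z ((γ : SL(2, ℝ)) • w) ≤
      C * (K * N * T) / volume (Metric.ball w 1) := by
    intro z
    rw [ENNReal.le_div_iff_mul_le (.inl hm0) (.inl hm1), ← ENNReal.tsum_mul_right]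
    -- Summing the local integrals costs only the overlap bound, and the remaining integral over `ℍ`
    -- does not depend on `z`, by invariance of the measure.
    calc _ ≤ ∑' γ : cover Γ,
          C * ∫⁻ u, (Metric.ball ((γ : SL(2, ℝ)) • w) 1).indicator 1 u * a z u :=
          ENNReal.tsum_le_tsum (hlocal z)
      _ = C * ∫⁻ u, (∑' γ : cover Γ,
          (Metric.ball ((γ : SL(2, ℝ)) • w) 1).indicator (1 : ℍ → ENNReal) u) * a z u := by
          rw [ENNReal.tsum_mul_left, ← lintegral_tsum fun γ => by
            refine (Measurable.mul ?_ (ha z).measurable).aemeasurable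
            exact measurable_one.indicator Metric.isOpen_ball.measurableSet]
          simp_rw [ENNReal.tsum_mul_right]
      _ ≤ C * ∫⁻ u, K * N * a z u := by
          gcongr with u
          exact hmult u
      _ = C * (K * N * T) := by
          rw [lintegral_const_mul _ (ha z).measurable, lintegral_cosh_dist_eq]
  have hB : C * (K * N * T) / volume (Metric.ball w 1) < ⊤ :=
    ENNReal.div_lt_top (ENNReal.mul_lt_top ENNReal.ofReal_lt_top
      (ENNReal.mul_lt_top (ENNReal.mul_lt_top ENNReal.ofReal_lt_top hN) hT)).ne hm0
  refine ⟨(C * (K * N * T) / volume (Metric.ball w 1)).toReal, fun z => ?_⟩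
  rw [← ENNReal.ofReal_le_iff_le_toReal hB.ne,
    ENNReal.ofReal_tsum_of_nonneg (fun γ => by positivity) (summable_cosh Γ hF hσ z w)]
  exact hsum z

section

/-! ### The hypergeometric factor -/

/-- Factor by factor, `|s + j| ≥ Re s + j ≥ 1 + j`. -/
theorem factorial_le_norm_ascPochhammer_eval {s : ℂ} (hs : 1 ≤ s.re) (n : ℕ) :
    (n.factorial : ℝ) ≤ ‖(ascPochhammer ℂ n).eval s‖ := by
  induction n with
  | zero => simp
  | succ n ih =>
    rw [ascPochhammer_succ_eval, norm_mul, Nat.factorial_succ, mul_comm, Nat.cast_mul]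
    refine mul_le_mul ih ?_ (by positivity) (by positivity)
    refine le_trans ?_ (Complex.re_le_norm _)
    simp only [Complex.add_re, Complex.natCast_re, Nat.cast_add, Nat.cast_one]
    linarith

theorem ascPochhammer_eval_ne_zero {s : ℂ} (hs : 1 ≤ s.re) (n : ℕ) :
    (ascPochhammer ℂ n).eval s ≠ 0 := by
  have h := factorial_le_norm_ascPochhammer_eval hs n
  have h' : (0 : ℝ) < n.factorial := by positivity
  exact norm_pos_iff.mp (h'.trans_le h)

/-- The terms of a convergent series dominating `F(-k, k; s; x)` for `Re s ≥ 1`, `|x| ≤ 1/2`. -/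
def hypBound (k : ℝ) (n : ℕ) : ℝ :=
  ‖ordinaryHypergeometricCoefficient (-(k : ℂ)) (k : ℂ) 1 n‖ * (1 / 2) ^ n

/-- The radius is 1 unless `k` or `-k` is a natural number; then the series is a polynomial. The
third parameter 1 is never a non-positive integer. -/
theorem one_le_hypergeometric_radius (k : ℝ) :
    1 ≤ (ordinaryHypergeometricSeries ℂ (-(k : ℂ)) (k : ℂ) 1).radius := by
  by_cases h : ∀ m : ℕ, (m : ℂ) ≠ -(-(k : ℂ)) ∧ (m : ℂ) ≠ -(k : ℂ) ∧ (m : ℂ) ≠ -1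
  · exact (ordinaryHypergeometricSeries_radius_eq_one ℂ _ _ _ h).ge
  · push Not at h
    obtain ⟨m, hm⟩ := h
    by_cases h1 : (m : ℂ) = -(-(k : ℂ))
    · have : -(k : ℂ) = -(m : ℂ) := by rw [h1]; ring
      rw [this, ordinaryHypergeometric_radius_top_of_neg_nat₁]
      exact le_top
    · by_cases h2 : (m : ℂ) = -(k : ℂ)
      · have : (k : ℂ) = -(m : ℂ) := by rw [h2]; ring
        nth_rewrite 2 [this]
        rw [ordinaryHypergeometric_radius_top_of_neg_nat₂]
        exact le_top
      · have := congrArg Complex.re (hm h1 h2)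
        simp only [Complex.natCast_re, Complex.neg_re, Complex.one_re] at this
        have h0 : (0 : ℝ) ≤ m := m.cast_nonneg
        linarith

theorem summable_hypBound (k : ℝ) : Summable (hypBound k) := by
  have hmem : (1 / 2 : ℂ) ∈
      Metric.eball 0 (ordinaryHypergeometricSeries ℂ (-(k : ℂ)) (k : ℂ) 1).radius := by
    refine Metric.eball_subset_eball (one_le_hypergeometric_radius k) ?_
    rw [Metric.mem_eball, edist_zero_right, ← ofReal_norm, ENNReal.ofReal_lt_one]
    norm_num
  refine (FormalMultilinearSeries.summable_norm_apply _ hmem).congr fun n => ?_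
  rw [ordinaryHypergeometricSeries_apply_eq, norm_smul, norm_pow, hypBound]
  norm_num

/-- Since `(1)_n = n!` is at most `|(s)_n|`, the case `s = 1`, `x = 1/2` majorizes all others. -/
theorem norm_hypergeometric_term_le (k : ℝ) {s : ℂ} (hs : 1 ≤ s.re) {x : ℂ} (hx : ‖x‖ ≤ 1 / 2)
    (n : ℕ) :
    ‖ordinaryHypergeometricCoefficient (-(k : ℂ)) (k : ℂ) s n • x ^ n‖ ≤ hypBound k n := by
  rw [norm_smul, norm_pow, hypBound]
  gcongr ?_ * ?_ ^ n
  simp only [norm_mul, norm_inv]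
  gcongr ?_ * ?_⁻¹
  · exact norm_pos_iff.mpr (ascPochhammer_eval_ne_zero (by simp) n)
  · rw [ascPochhammer_eval_one]
    simpa using factorial_le_norm_ascPochhammer_eval hs n

theorem hypergeometric_eq_tsum (k : ℝ) (s x : ℂ) :
    ordinaryHypergeometric (-(k : ℂ)) (k : ℂ) s x =
      ∑' n, ordinaryHypergeometricCoefficient (-(k : ℂ)) (k : ℂ) s n • x ^ n := by
  rw [ordinaryHypergeometric_eq_tsum]

theorem norm_hypergeometric_le (k : ℝ) {s : ℂ} (hs : 1 ≤ s.re) {x : ℂ} (hx : ‖x‖ ≤ 1 / 2) :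
    ‖ordinaryHypergeometric (-(k : ℂ)) (k : ℂ) s x‖ ≤ ∑' n, hypBound k n := by
  rw [hypergeometric_eq_tsum]
  exact tsum_of_norm_bounded (summable_hypBound k).hasSum (norm_hypergeometric_term_le k hs hx)

theorem continuousOn_hypergeometric (k : ℝ) {s : ℂ} (hs : 1 ≤ s.re) :
    ContinuousOn (ordinaryHypergeometric (-(k : ℂ)) (k : ℂ) s)
      (Metric.closedBall (0 : ℂ) (1 / 2)) := by
  have : ordinaryHypergeometric (-(k : ℂ)) (k : ℂ) s = fun x : ℂ =>
      ∑' n, ordinaryHypergeometricCoefficient (-(k : ℂ)) (k : ℂ) s n • x ^ n :=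
    funext fun x => hypergeometric_eq_tsum k s x
  rw [this]
  refine continuousOn_tsum (fun n => by fun_prop) (summable_hypBound k) fun n x hx => ?_
  exact norm_hypergeometric_term_le k hs (mem_closedBall_zero_iff.mp hx) n

theorem differentiableOn_hypergeometric (k : ℝ) {x : ℂ} (hx : ‖x‖ ≤ 1 / 2) :
    DifferentiableOn ℂ (fun s => ordinaryHypergeometric (-(k : ℂ)) (k : ℂ) s x)
      {s : ℂ | 1 < s.re} := by
  simp_rw [hypergeometric_eq_tsum]
  refine Complex.differentiableOn_tsum_of_summable_norm (summable_hypBound k) (fun n => ?_)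
    (isOpen_lt continuous_const Complex.continuous_re)
    fun n s hs => norm_hypergeometric_term_le k (le_of_lt hs) hx n
  refine DifferentiableOn.smul_const (DifferentiableOn.const_mul ?_ _) _
  exact (ascPochhammer ℂ n).differentiable.differentiableOn.inv
    fun s hs => ascPochhammer_eval_ne_zero (le_of_lt hs) n

/-! ### The factors of absolute value one -/

theorem im_sub_conj_pos (z w : ℍ) : 0 < ((z : ℂ) - (starRingEnd ℂ) (w : ℂ)).im := by
  have := z.im_pos
  have := w.im_pos
  simp only [Complex.sub_im, Complex.conj_im, coe_im]
  linarith

theorem arg_mem_Ioo_of_im_pos {u : ℂ} (hu : 0 < u.im) : u.arg ∈ Set.Ioo 0 Real.pi := by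
  refine ⟨(Complex.arg_nonneg_iff.mpr hu.le).lt_of_ne fun h => ?_,
    Complex.arg_lt_pi_iff.mpr (.inr hu.ne')⟩
  exact hu.ne' (Complex.arg_eq_zero_iff.mp h.symm).2

theorem arg_mem_Ioo_of_im_neg {u : ℂ} (hu : u.im < 0) : u.arg ∈ Set.Ioo (-Real.pi) 0 :=
  ⟨Complex.neg_pi_lt_arg u, Complex.arg_neg_iff.mpr hu⟩

/-- As `z - w̄` lies in the upper half-plane, `π - 2 arg(z - w̄)` lies in `(-π, π)` and is the
principal argument of the base. Identities for `H` become additive identities of arguments. -/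
theorem H_eq_exp (k : ℝ) (z w : ℍ) :
    H k z w = Complex.exp
      (Complex.I * k * (Real.pi - 2 * ((z : ℂ) - (starRingEnd ℂ) (w : ℂ)).arg)) := by
  set u : ℂ := (z : ℂ) - (starRingEnd ℂ) (w : ℂ)
  have hu : 0 < u.im := im_sub_conj_pos z w
  have hu0 : u ≠ 0 := fun h => by simp [h] at hu
  have harg := arg_mem_Ioo_of_im_pos hu
  have hbase : -((‖u‖ : ℂ) ^ 2 / u ^ 2) =
      Complex.exp (((Real.pi - 2 * u.arg : ℝ) : ℂ) * Complex.I) := by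
    have h1 : u = ‖u‖ * Complex.exp (u.arg * Complex.I) := (Complex.norm_mul_exp_arg_mul_I u).symm
    have hn : (‖u‖ : ℂ) ≠ 0 := by simpa using hu0
    have h2 : Complex.exp (((Real.pi - 2 * u.arg : ℝ) : ℂ) * Complex.I) =
        -(Complex.exp (u.arg * Complex.I) ^ 2)⁻¹ := by
      rw [← Complex.exp_nat_mul, ← Complex.exp_neg, neg_eq_neg_one_mul, ← Complex.exp_pi_mul_I,
        ← Complex.exp_add]
      congr 1
      push_cast
      ring
    have h3 : u ^ 2 = (‖u‖ : ℂ) ^ 2 * Complex.exp (u.arg * Complex.I) ^ 2 := by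
      conv_lhs => rw [h1]
      ring
    rw [h2, h3, div_mul_eq_div_div, div_self (pow_ne_zero 2 hn), one_div]
  change (-((‖u‖ : ℂ) ^ 2 / u ^ 2)) ^ (k : ℂ) = _
  rw [hbase, Complex.cpow_def_of_ne_zero (Complex.exp_ne_zero _), Complex.log_exp]
  · congr 1
    push_cast
    ring
  · rw [Complex.im_ofReal_mul, Complex.I_im]
    linarith [harg.2]
  · rw [Complex.im_ofReal_mul, Complex.I_im]
    linarith [harg.1]

theorem norm_H (k : ℝ) (z w : ℍ) : ‖H k z w‖ = 1 := by
  rw [H_eq_exp, Complex.norm_exp]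
  simp

theorem norm_J (k : ℝ) (γ : SL(2, ℝ)) (z : ℍ) : ‖J k γ z‖ = 1 := by
  rw [J, Complex.norm_exp]
  simp

theorem J_ne_zero (k : ℝ) (γ : SL(2, ℝ)) (z : ℍ) : J k γ z ≠ 0 := Complex.exp_ne_zero _

theorem continuous_H_left (k : ℝ) (w : ℍ) : Continuous fun z => H k z w := by
  simp_rw [H_eq_exp]
  have h : Continuous fun z : ℍ => ((z : ℂ) - (starRingEnd ℂ) (w : ℂ)).arg := by
    refine continuous_iff_continuousAt.mpr fun z => ?_
    exact (Complex.continuousAt_arg (.inr (im_sub_conj_pos z w).ne')).comp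
      (f := fun z : ℍ => (z : ℂ) - (starRingEnd ℂ) (w : ℂ)) (by fun_prop)
  fun_prop

/-! ### The summands -/

theorem norm_inv_one_add_cosh_le (d : ℝ) : ‖(((1 + Real.cosh d)⁻¹ : ℝ) : ℂ)‖ ≤ 1 / 2 := by
  have := Real.one_le_cosh d
  rw [Complex.norm_real, Real.norm_of_nonneg (by positivity), one_div]
  gcongr
  linarith

variable {V : Type*} [NormedAddCommGroup V] [InnerProductSpace ℂ V]

theorem toEnd_apply (u : V ≃ₗᵢ[ℂ] V) (v : V) : toEnd u v = u v := rfl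

theorem norm_toEnd_le (u : V ≃ₗᵢ[ℂ] V) : ‖toEnd u‖ ≤ 1 :=
  ContinuousLinearMap.opNorm_le_bound _ zero_le_one fun v => by
    rw [toEnd_apply, LinearIsometryEquiv.norm_map, one_mul]

variable (Γ : Subgroup PSL2R) (k : ℝ) (χ : cover Γ → (V ≃ₗᵢ[ℂ] V))

theorem norm_term_le (γ : cover Γ) {s : ℂ} (hs : 1 ≤ s.re) (z w : ℍ) :
    ‖term Γ k χ γ s z w‖ ≤
      (∑' n, hypBound k n) * Real.cosh (dist z ((γ : SL(2, ℝ)) • w)) ^ (-s.re) := by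
  rw [term, norm_smul, norm_mul, norm_mul, norm_mul, norm_H, norm_J,
    Complex.norm_cpow_eq_rpow_re_of_pos (Real.cosh_pos _), Complex.neg_re, mul_one, mul_one]
  have h := norm_hypergeometric_le k hs
    (norm_inv_one_add_cosh_le (dist z ((γ : SL(2, ℝ)) • w)))
  have hp : 0 ≤ Real.cosh (dist z ((γ : SL(2, ℝ)) • w)) ^ (-s.re) := by positivity
  calc _ ≤ Real.cosh (dist z ((γ : SL(2, ℝ)) • w)) ^ (-s.re) * (∑' n, hypBound k n) * 1 := by
        have h0 : 0 ≤ ∑' n, hypBound k n := (norm_nonneg _).trans h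
        gcongr
        exact norm_toEnd_le (χ γ)
    _ = _ := by ring

theorem continuous_term_left (γ : cover Γ) {s : ℂ} (hs : 1 ≤ s.re) (w : ℍ) :
    Continuous fun z => term Γ k χ γ s z w := by
  have hd : Continuous fun z : ℍ => Real.cosh (dist z ((γ : SL(2, ℝ)) • w)) := by fun_prop
  have h1 : Continuous fun z : ℍ =>
      (Real.cosh (dist z ((γ : SL(2, ℝ)) • w)) : ℂ) ^ (-s) :=
    (Complex.continuous_ofReal.comp hd).cpow continuous_const
      fun z => .inl (by simpa using Real.cosh_pos _)
  have h2 : Continuous fun z : ℍ => ordinaryHypergeometric (-(k : ℂ)) (k : ℂ) s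
      (((1 + Real.cosh (dist z ((γ : SL(2, ℝ)) • w)))⁻¹ : ℝ) : ℂ) := by
    refine (continuousOn_hypergeometric k hs).comp_continuous ?_ fun z => ?_
    · exact Complex.continuous_ofReal.comp ((continuous_const.add hd).inv₀ fun z =>
        (add_pos one_pos (Real.cosh_pos _)).ne')
    · exact mem_closedBall_zero_iff.mpr (norm_inv_one_add_cosh_le _)
  exact (((h1.mul h2).mul continuous_const).mul (continuous_H_left k _)).smul continuous_const

theorem differentiableOn_term (γ : cover Γ) (z w : ℍ) :
    DifferentiableOn ℂ (fun s => term Γ k χ γ s z w) {s : ℂ | 1 < s.re} := by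
  have h1 : Differentiable ℂ fun s : ℂ =>
      (Real.cosh (dist z ((γ : SL(2, ℝ)) • w)) : ℂ) ^ (-s) :=
    differentiable_id.neg.const_cpow (.inl (by exact_mod_cast (Real.cosh_pos _).ne'))
  exact (((h1.differentiableOn.mul (differentiableOn_hypergeometric k
    (norm_inv_one_add_cosh_le _))).mul_const _).mul_const _).smul_const _

variable [DiscreteTopology Γ] {F : Set ℍ}

/-- The majorant is the orbit sum at `(i, i)`; the factor `e^R` pays for moving `(z, w)` to `(i,
i)`, with `R` bounding `d(i,z) + d(w,i)` on `C`. -/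
theorem exists_summable_norm_term_le (hF : IsFundamentalDomain Γ F (volume : Measure ℍ))
    {C : Set (ℍ × ℍ)} (hC : IsCompact C) {σ : ℝ} (hσ : 1 < σ) :
    ∃ M : cover Γ → ℝ, Summable M ∧
      ∀ γ, ∀ p ∈ C, ∀ s : ℂ, σ ≤ s.re → ‖term Γ k χ γ s p.1 p.2‖ ≤ M γ := by
  obtain ⟨R, hR⟩ := (hC.image (f := fun p : ℍ × ℍ => dist I p.1 + dist p.2 I)
    (by fun_prop)).bddAbove
  have hR' : ∀ p ∈ C, dist I p.1 + dist p.2 I ≤ R := fun p hp => hR ⟨p, hp, rfl⟩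
  have h0 : 0 ≤ ∑' n, hypBound k n := tsum_nonneg fun n => by unfold hypBound; positivity
  refine ⟨fun γ => (∑' n, hypBound k n) *
    ((2 * Real.exp R) ^ σ * Real.cosh (dist I ((γ : SL(2, ℝ)) • I)) ^ (-σ)),
    ((summable_cosh Γ hF hσ I I).mul_left _).mul_left _, fun γ p hp s hs => ?_⟩
  refine (norm_term_le Γ k χ γ (by linarith) p.1 p.2).trans ?_
  refine mul_le_mul_of_nonneg_left ?_ h0
  calc Real.cosh (dist p.1 ((γ : SL(2, ℝ)) • p.2)) ^ (-s.re)
      ≤ Real.cosh (dist p.1 ((γ : SL(2, ℝ)) • p.2)) ^ (-σ) :=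
        Real.rpow_le_rpow_of_exponent_le (Real.one_le_cosh _) (by linarith)
    _ ≤ _ := by
        refine cosh_rpow_neg_le (by linarith) dist_nonneg ?_
        have e := dist_triangle4 I p.1 ((γ : SL(2, ℝ)) • p.2) ((γ : SL(2, ℝ)) • I)
        rw [dist_smul] at e
        linarith [hR' p hp]

/-- Bounds on compacta would not suffice for square-integrability, as `F` may be non-compact. -/
theorem exists_norm_kernelSum_le (hF : IsFundamentalDomain Γ F (volume : Measure ℍ))
    {s : ℂ} (hs : 1 < s.re) (w : ℍ) :
    ∃ B : ℝ, ∀ z, ‖kernelSum Γ k χ s z w‖ ≤ B := by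
  obtain ⟨B, hB⟩ := exists_tsum_cosh_le Γ hF hs w
  have h0 : 0 ≤ ∑' n, hypBound k n := tsum_nonneg fun n => by unfold hypBound; positivity
  refine ⟨(∑' n, hypBound k n) * B, fun z => ?_⟩
  refine (tsum_of_norm_bounded ((summable_cosh Γ hF hs z w).mul_left _).hasSum
    fun γ => norm_term_le Γ k χ γ hs.le z w).trans ?_
  rw [tsum_mul_left]
  gcongr
  exact hB z

variable [FiniteDimensional ℂ V]

theorem summable_term (hF : IsFundamentalDomain Γ F (volume : Measure ℍ))
    {s : ℂ} (hs : 1 < s.re) (z w : ℍ) :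
    Summable fun γ => term Γ k χ γ s z w := by
  have : CompleteSpace V := FiniteDimensional.complete ℂ V
  obtain ⟨M, hM, hle⟩ := exists_summable_norm_term_le Γ k χ hF
    (isCompact_singleton (x := (z, w))) hs
  exact .of_norm_bounded hM fun γ => hle γ _ rfl s le_rfl

theorem differentiableOn_kernelSum (hF : IsFundamentalDomain Γ F (volume : Measure ℍ))
    (z w : ℍ) :
    DifferentiableOn ℂ (fun s => kernelSum Γ k χ s z w) {s : ℂ | 1 < s.re} := by
  have : CompleteSpace V := FiniteDimensional.complete ℂ V
  intro s₀ hs₀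
  -- The majorant is uniform only on `Re s ≥ σ > 1`, so one works in an open half-plane around `s₀`.
  obtain ⟨σ, hσ, hσs⟩ := exists_between (show 1 < s₀.re from hs₀)
  obtain ⟨M, hM, hle⟩ := exists_summable_norm_term_le Γ k χ hF
    (isCompact_singleton (x := (z, w))) hσ
  have hopen : IsOpen {s : ℂ | σ < s.re} := isOpen_lt continuous_const Complex.continuous_re
  have h := Complex.differentiableOn_tsum_of_summable_norm hM
    (fun γ => (differentiableOn_term Γ k χ γ z w).mono fun s hs => hσ.trans hs)
    hopen fun γ s hs => hle γ _ rfl s (le_of_lt hs)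
  exact (h.differentiableAt (hopen.mem_nhds hσs)).differentiableWithinAt

theorem continuous_kernelSum_left (hF : IsFundamentalDomain Γ F (volume : Measure ℍ))
    {s : ℂ} (hs : 1 < s.re) (w : ℍ) :
    Continuous fun z => kernelSum Γ k χ s z w := by
  have : CompleteSpace V := FiniteDimensional.complete ℂ V
  refine continuous_iff_continuousAt.mpr fun z₀ => ?_
  obtain ⟨M, hM, hle⟩ := exists_summable_norm_term_le Γ k χ hF
    ((isCompact_closedBall z₀ 1).prod (isCompact_singleton (x := w))) hs
  have h : ContinuousOn (fun z => kernelSum Γ k χ s z w) (Metric.closedBall z₀ 1) :=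
    continuousOn_tsum (fun γ => (continuous_term_left Γ k χ γ hs.le w).continuousOn) hM
      fun γ z hz => hle γ (z, w) ⟨hz, rfl⟩ s le_rfl
  exact h.continuousAt (Metric.closedBall_mem_nhds z₀ one_pos)

end

section

/-! ### The automorphy factor and its argument -/

theorem j_im (γ : SL(2, ℝ)) (z : ℍ) : (j γ z).im = γ 1 0 * z.im := by
  simp [j]

theorem j_ne_zero (γ : SL(2, ℝ)) (z : ℍ) : j γ z ≠ 0 :=
  denom_ne_zero (Matrix.SpecialLinearGroup.toGL γ) z

theorem coe_smul_eq_div (γ : SL(2, ℝ)) (z : ℍ) :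
    ((γ • z : ℍ) : ℂ) = ((γ 0 0 : ℂ) * z + γ 0 1) / j γ z := by
  rw [coe_specialLinearGroup_apply]
  rfl

theorem det_eq_one (γ : SL(2, ℝ)) :
    (γ 0 0 : ℂ) * γ 1 1 - (γ 0 1 : ℂ) * γ 1 0 = 1 := by
  have h := γ.det_coe
  rw [Matrix.det_fin_two] at h
  exact_mod_cast h

theorem j_mul (γ δ : SL(2, ℝ)) (z : ℍ) : j (γ * δ) z = j γ (δ • z) * j δ z := by
  have h := j_ne_zero δ z
  rw [j, j, coe_smul_eq_div]
  field_simp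
  simp only [Matrix.SpecialLinearGroup.coe_mul, Matrix.mul_apply, Fin.sum_univ_two, j]
  push_cast
  ring

theorem smul_sub_conj_smul (γ : SL(2, ℝ)) (z u : ℍ) :
    ((γ • z : ℍ) : ℂ) - (starRingEnd ℂ) ((γ • u : ℍ) : ℂ) =
      ((z : ℂ) - (starRingEnd ℂ) (u : ℂ)) / (j γ z * (starRingEnd ℂ) (j γ u)) := by
  have h := j_ne_zero γ z
  have h' : (starRingEnd ℂ) (j γ u) ≠ 0 := (map_ne_zero _).mpr (j_ne_zero γ u)
  have hdet := det_eq_one γ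
  rw [coe_smul_eq_div, coe_smul_eq_div, map_div₀]
  field_simp
  simp only [j, map_add, map_mul, Complex.conj_ofReal]
  linear_combination ((z : ℂ) - (starRingEnd ℂ) (u : ℂ)) * hdet

/-- For `c ≠ 0` the imaginary part of `cz + d` never vanishes, so the branch cut is avoided; for `c
= 0` the function is constant. -/
theorem continuous_arg_j (γ : SL(2, ℝ)) : Continuous fun z : ℍ => (j γ z).arg := by
  by_cases hc : γ 1 0 = 0
  · simp only [j, hc]
    simp only [Complex.ofReal_zero, zero_mul, zero_add]
    exact continuous_const
  · refine continuous_iff_continuousAt.mpr fun z => ?_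
    refine (Complex.continuousAt_arg (.inr ?_)).comp (f := fun z : ℍ => j γ z) ?_
    · rw [j_im]
      exact mul_ne_zero hc z.im_ne_zero
    · unfold j
      fun_prop

theorem abs_arg_j_sub_lt (γ : SL(2, ℝ)) (z u : ℍ) :
    |(j γ z).arg - (j γ u).arg| < Real.pi := by
  rw [abs_lt]
  rcases lt_trichotomy (γ 1 0) 0 with hc | hc | hc
  · have h (z : ℍ) : (j γ z).arg ∈ Set.Ioo (-Real.pi) 0 := arg_mem_Ioo_of_im_neg (by
      rw [j_im]; exact mul_neg_of_neg_of_pos hc z.im_pos)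
    constructor <;> linarith [(h z).1, (h z).2, (h u).1, (h u).2]
  · have h : j γ z = j γ u := by simp [j, hc]
    rw [h, sub_self]
    exact ⟨by linarith [Real.pi_pos], Real.pi_pos⟩
  · have h (z : ℍ) : (j γ z).arg ∈ Set.Ioo 0 Real.pi := arg_mem_Ioo_of_im_pos (by
      rw [j_im]; exact mul_pos hc z.im_pos)
    constructor <;> linarith [(h z).1, (h z).2, (h u).1, (h u).2]

/-- The defining equation of `w(γ, δ)` holds at every point of the upper half-plane. -/
theorem two_pi_mul_wFactor (γ δ : SL(2, ℝ)) (z : ℍ) :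
    2 * Real.pi * wFactor γ δ =
      (j γ (δ • z)).arg + (j δ z).arg - (j (γ * δ) z).arg := by
  set f : ℍ → ℝ := fun z =>
    ((j γ (δ • z)).arg + (j δ z).arg - (j (γ * δ) z).arg) / (2 * Real.pi)
  have hf : Continuous f :=
    ((((continuous_arg_j γ).comp (continuous_const_smul δ)).add (continuous_arg_j δ)).sub
      (continuous_arg_j (γ * δ))).div_const _
  -- By `j_mul` the arguments agree modulo `2π`, so the continuous function `f` is integer-valued,
  -- hence constant on the connected space `ℍ`.
  have hmaps : Set.MapsTo f Set.univ (Set.range ((↑) : ℤ → ℝ)) := fun z _ => by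
    have h : (((j γ (δ • z)).arg + (j δ z).arg : ℝ) : Real.Angle) = (j (γ * δ) z).arg := by
      rw [j_mul, Complex.arg_mul_coe_angle (j_ne_zero _ _) (j_ne_zero _ _), Real.Angle.coe_add]
    obtain ⟨m, hm⟩ := Real.Angle.angle_eq_iff_two_pi_dvd_sub.mp h
    refine ⟨m, ?_⟩
    simp only [f, hm]
    field_simp
  obtain ⟨y, -, hy⟩ := isPreconnected_univ.eqOn_const_of_mapsTo
    Int.isClosedEmbedding_coe_real.isEmbedding.isDiscrete_range hf.continuousOn hmaps
    (Set.range_nonempty _)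
  have h : wFactor γ δ = f z := (hy (Set.mem_univ I)).trans (hy (Set.mem_univ z)).symm
  rw [h]
  simp only [f]
  field_simp

theorem omega_mul_J (k : ℝ) (γ δ : SL(2, ℝ)) (z : ℍ) :
    omega k γ δ * J k (γ * δ) z = J k γ (δ • z) * J k δ z := by
  rw [omega, J, J, J, ← Complex.exp_add, ← Complex.exp_add]
  congr 1
  have h : (2 * Real.pi * wFactor γ δ : ℂ) =
      (j γ (δ • z)).arg + (j δ z).arg - (j (γ * δ) z).arg := by
    exact_mod_cast two_pi_mul_wFactor γ δ z
  linear_combination (2 * Complex.I * k) * h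

/-- By `smul_sub_conj_smul` both sides agree modulo `2π`. The two arguments of differences lie in
`(0, π)` and the arguments of `j` differ by less than `π`, so the discrepancy is less than `2π` in
absolute value and vanishes. -/
theorem arg_smul_sub_conj_smul (γ : SL(2, ℝ)) (z u : ℍ) :
    (((γ • z : ℍ) : ℂ) - (starRingEnd ℂ) ((γ • u : ℍ) : ℂ)).arg =
      ((z : ℂ) - (starRingEnd ℂ) (u : ℂ)).arg - (j γ z).arg + (j γ u).arg := by
  have h0 := arg_mem_Ioo_of_im_pos (im_sub_conj_pos z u)
  have h1 := arg_mem_Ioo_of_im_pos (im_sub_conj_pos (γ • z) (γ • u))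
  have h2 := abs_lt.mp (abs_arg_j_sub_lt γ z u)
  have hne : (z : ℂ) - (starRingEnd ℂ) (u : ℂ) ≠ 0 := fun h => by
    have := im_sub_conj_pos z u
    simp [h] at this
  have h' : (starRingEnd ℂ) (j γ u) ≠ 0 := (map_ne_zero _).mpr (j_ne_zero γ u)
  have hangle : ((((γ • z : ℍ) : ℂ) - (starRingEnd ℂ) ((γ • u : ℍ) : ℂ)).arg : Real.Angle) =
      ((((z : ℂ) - (starRingEnd ℂ) (u : ℂ)).arg - (j γ z).arg + (j γ u).arg : ℝ) :
        Real.Angle) := by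
    rw [smul_sub_conj_smul, Complex.arg_div_coe_angle hne (mul_ne_zero (j_ne_zero γ z) h'),
      Complex.arg_mul_coe_angle (j_ne_zero γ z) h', Complex.arg_conj_coe_angle,
      Real.Angle.coe_add, Real.Angle.coe_sub]
    abel
  obtain ⟨m, hm⟩ := Real.Angle.angle_eq_iff_two_pi_dvd_sub.mp hangle
  have hpi := Real.pi_pos
  have hm1 : (m : ℝ) < 1 := by
    by_contra h
    push Not at h
    nlinarith [h0.1, h1.2]
  have hm2 : (-1 : ℝ) < m := by
    by_contra h
    push Not at h
    nlinarith [h0.2, h1.1]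
  have hm0 : m = 0 := by
    have a : m < 1 := by exact_mod_cast hm1
    have b : -1 < m := by exact_mod_cast hm2
    omega
  rw [hm0, Int.cast_zero, mul_zero] at hm
  linarith

theorem H_smul (k : ℝ) (γ : SL(2, ℝ)) (z u : ℍ) :
    J k γ u * H k (γ • z) (γ • u) = J k γ z * H k z u := by
  rw [H_eq_exp, H_eq_exp, arg_smul_sub_conj_smul, J, J, ← Complex.exp_add, ← Complex.exp_add]
  congr 1
  push_cast
  ring

/-! ### Automorphy of the kernel -/

variable {V : Type*} [NormedAddCommGroup V] [InnerProductSpace ℂ V]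
  {Γ : Subgroup PSL2R} {k : ℝ} {χ : cover Γ → (V ≃ₗᵢ[ℂ] V)}

/-- The factor `ω` from `χ(γδ)` turns `J_{γδ}(w)` into `J_γ(δw) J_δ(w)`, and `H_smul` trades
`J_γ(δw)` for `J_γ(z)`; the rest depends only on the invariant distance. -/
theorem term_mul_smul (hχ : IsMultiplierSystem Γ k χ) (γ δ : cover Γ) (s : ℂ) (z w : ℍ) :
    term Γ k χ (γ * δ) s ((γ : SL(2, ℝ)) • z) w =
      J k γ z • (toEnd (χ γ)).comp (term Γ k χ δ s z w) := by
  ext v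
  have hw : ((γ : SL(2, ℝ)) * (δ : SL(2, ℝ))) • w = (γ : SL(2, ℝ)) • (δ : SL(2, ℝ)) • w :=
    mul_smul _ _ _
  have h1 := omega_mul_J k γ δ w
  have h2 := H_smul k γ z ((δ : SL(2, ℝ)) • w)
  have h3 : omega k γ δ * J k (γ * δ) w *
      H k ((γ : SL(2, ℝ)) • z) ((γ : SL(2, ℝ)) • (δ : SL(2, ℝ)) • w) =
      J k γ z * J k δ w * H k z ((δ : SL(2, ℝ)) • w) := by
    rw [h1]
    linear_combination J k δ w * h2
  simp only [term, Subgroup.coe_mul, hw, dist_smul, smul_apply,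
    ContinuousLinearMap.comp_apply, toEnd_apply, map_smul, hχ.map_mul]
  rw [smul_smul (α := V), smul_smul (α := V)]
  congr 1
  linear_combination (Real.cosh (dist z ((δ : SL(2, ℝ)) • w)) : ℂ) ^ (-s)
    * ordinaryHypergeometric (-(k : ℂ)) (k : ℂ) s
        (((1 + Real.cosh (dist z ((δ : SL(2, ℝ)) • w)))⁻¹ : ℝ) : ℂ) * h3

theorem kernelSum_smul (hχ : IsMultiplierSystem Γ k χ) {s : ℂ} {z w : ℍ}
    (hsum : Summable fun γ => term Γ k χ γ s z w) (γ : cover Γ) :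
    kernelSum Γ k χ s ((γ : SL(2, ℝ)) • z) w =
      J k γ z • (toEnd (χ γ)).comp (kernelSum Γ k χ s z w) := by
  rw [kernelSum, ← (Equiv.mulLeft γ).tsum_eq]
  simp only [Equiv.coe_mulLeft, term_mul_smul hχ]
  exact ((((ContinuousLinearMap.compL ℂ V V V) (toEnd (χ γ))).hasSum hsum.hasSum).const_smul
    (J k γ z)).tsum_eq

end

/-! ### Poles of the Gamma factor -/

/-- `1/Γ` is entire and nonzero at such points. -/
theorem analyticAt_Gamma {s : ℂ} (hs : ∀ m : ℕ, s ≠ -m) : AnalyticAt ℂ Complex.Gamma s := by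
  have h : AnalyticAt ℂ (fun s => (Complex.Gamma s)⁻¹) s :=
    Complex.differentiable_one_div_Gamma.analyticAt s
  exact (h.fun_inv (inv_ne_zero (Complex.Gamma_ne_zero hs))).congr
    (.of_forall fun s => inv_inv (Complex.Gamma s))

theorem ne_neg_nat_of_re_pos {s : ℂ} (hs : 0 < s.re) (m : ℕ) : s ≠ -m := fun h => by
  have := congrArg Complex.re h
  simp only [Complex.neg_re, Complex.natCast_re] at this
  have h0 : (0 : ℝ) ≤ m := m.cast_nonneg
  linarith

/-- Use `Γ(s) = Γ(s+1)/s`: at 0 the pole comes from `1/s`; at `-(n+1)` the factor `1/s` is analytic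
and nonzero, so the order is that of `Γ` at `-n`. -/
theorem meromorphicOrderAt_Gamma_neg_nat (n : ℕ) :
    meromorphicOrderAt Complex.Gamma (-(n : ℂ)) = -1 := by
  induction n with
  | zero =>
    have heq : Complex.Gamma =ᶠ[nhdsWithin (-((0 : ℕ) : ℂ)) {-((0 : ℕ) : ℂ)}ᶜ]
        (fun s => Complex.Gamma (s + 1)) * fun s => s⁻¹ := by
      filter_upwards [self_mem_nhdsWithin] with s hs
      have hs0 : s ≠ 0 := by simpa using hs
      simp only [Pi.mul_apply, Complex.Gamma_add_one s hs0]
      field_simp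
    have han : AnalyticAt ℂ (fun s => Complex.Gamma (s + 1)) (-((0 : ℕ) : ℂ)) :=
      (analyticAt_Gamma (ne_neg_nat_of_re_pos (by simp))).fun_comp (by fun_prop)
    rw [meromorphicOrderAt_congr heq, meromorphicOrderAt_mul_of_ne_zero han (by simp)]
    have h := meromorphicOrderAt_inv (f := (id : ℂ → ℂ)) (x := 0)
    rw [meromorphicOrderAt_id] at h
    rw [Nat.cast_zero, neg_zero]
    exact h
  | succ n ih =>
    have hx : (-((n + 1 : ℕ) : ℂ)) ≠ 0 := by
      rw [neg_ne_zero]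
      exact Nat.cast_ne_zero.mpr n.succ_ne_zero
    have heq : Complex.Gamma =ᶠ[nhdsWithin (-((n + 1 : ℕ) : ℂ)) {-((n + 1 : ℕ) : ℂ)}ᶜ]
        (fun s => s⁻¹) * (Complex.Gamma ∘ (· + 1)) := by
      filter_upwards [nhdsWithin_le_nhds (isOpen_ne.mem_nhds hx)] with s hs0
      have hs0 : s ≠ 0 := hs0
      simp only [Pi.mul_apply, Function.comp_apply, Complex.Gamma_add_one s hs0]
      field_simp
    rw [meromorphicOrderAt_congr heq,
      meromorphicOrderAt_mul_of_ne_zero (analyticAt_inv hx) (inv_ne_zero hx),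
      meromorphicOrderAt_comp_add_const_eq_meromorphicOrderAt]
    rw [← ih]
    congr 1
    push_cast
    ring

/-- The symmetry `k ↦ -k` isolates `Γ(s - |k|)` as the only source of poles in `Re s > 1`. -/
theorem gammaFactor_abs (k : ℝ) (s : ℂ) : gammaFactor k s = gammaFactor |k| s := by
  rcases abs_choice k with h | h
  · rw [h]
  · rw [h, gammaFactor, gammaFactor]
    push_cast
    rw [sub_neg_eq_add, ← sub_eq_add_neg, mul_comm (Complex.Gamma (s - k))]

/-- The cofactor of `Γ(s - |k|)` in the Gamma factor: it has no zeros and poles in `Re s > 1`. -/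
def regularFactor (k : ℝ) (s : ℂ) : ℂ :=
  Complex.Gamma (s + (|k| : ℝ)) / ((Real.sqrt (2 * Real.pi) : ℂ) * Complex.Gamma s ^ 2)

theorem gammaFactor_eq (k : ℝ) :
    gammaFactor k = regularFactor k * (Complex.Gamma ∘ (· - ((|k| : ℝ) : ℂ))) := by
  ext s
  rw [gammaFactor_abs, gammaFactor, Pi.mul_apply, regularFactor, Function.comp_apply]
  ring

theorem sqrt_two_pi_ne_zero : (Real.sqrt (2 * Real.pi) : ℂ) ≠ 0 := by
  exact_mod_cast (Real.sqrt_pos.mpr Real.two_pi_pos).ne'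

theorem regularFactor_ne_zero (k : ℝ) {s : ℂ} (hs : 1 < s.re) : regularFactor k s ≠ 0 := by
  refine div_ne_zero (Complex.Gamma_ne_zero (ne_neg_nat_of_re_pos ?_))
    (mul_ne_zero sqrt_two_pi_ne_zero
      (pow_ne_zero 2 (Complex.Gamma_ne_zero (ne_neg_nat_of_re_pos (by linarith)))))
  rw [Complex.add_re, Complex.ofReal_re]
  linarith [abs_nonneg k]

theorem analyticAt_regularFactor (k : ℝ) {s : ℂ} (hs : 1 < s.re) :
    AnalyticAt ℂ (regularFactor k) s := by
  have h1 : AnalyticAt ℂ (fun s => Complex.Gamma (s + (|k| : ℝ))) s := by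
    refine (analyticAt_Gamma (ne_neg_nat_of_re_pos ?_)).fun_comp (by fun_prop)
    rw [Complex.add_re, Complex.ofReal_re]
    linarith [abs_nonneg k]
  have h2 := analyticAt_Gamma (ne_neg_nat_of_re_pos (show 0 < s.re by linarith))
  exact h1.div (analyticAt_const.mul (h2.pow 2)) (mul_ne_zero sqrt_two_pi_ne_zero
      (pow_ne_zero 2 (Complex.Gamma_ne_zero (ne_neg_nat_of_re_pos (by linarith)))))

theorem meromorphicAt_gammaFactor (k : ℝ) {s : ℂ} (hs : 1 < s.re) :
    MeromorphicAt (gammaFactor k) s := by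
  rw [gammaFactor_eq]
  exact (analyticAt_regularFactor k hs).meromorphicAt.mul
    ((Meromorphic.Gamma _).comp_analyticAt (by fun_prop))

theorem analyticAt_gammaFactor (k : ℝ) {s : ℂ} (hs : 1 < s.re)
    (h : ¬ ∃ n : ℕ, (n : ℝ) ≤ |k| - 1 ∧ s = ((|k| - n : ℝ) : ℂ)) :
    AnalyticAt ℂ (gammaFactor k) s := by
  rw [gammaFactor_eq]
  refine (analyticAt_regularFactor k hs).mul
    ((analyticAt_Gamma fun m hm => h ⟨m, ?_, ?_⟩).fun_comp (by fun_prop))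
  · have := congrArg Complex.re hm
    simp only [Complex.sub_re, Complex.ofReal_re, Complex.neg_re, Complex.natCast_re] at this
    linarith
  · push_cast
    linear_combination hm

theorem meromorphicOrderAt_gammaFactor (k : ℝ) {n : ℕ} (hn : 1 < |k| - n) :
    meromorphicOrderAt (gammaFactor k) ((|k| - n : ℝ) : ℂ) = -1 := by
  have hs : 1 < (((|k| - n : ℝ) : ℂ)).re := by simpa using hn
  rw [gammaFactor_eq, meromorphicOrderAt_mul_of_ne_zero (analyticAt_regularFactor k hs)
    (regularFactor_ne_zero k hs), meromorphicOrderAt_comp_sub_const_eq_meromorphicOrderAt,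
    ← meromorphicOrderAt_Gamma_neg_nat n]
  congr 1
  push_cast
  ring

/-- Multiplying an analytic function by a scalar function with a simple pole yields a pole if and
only if the analytic function does not vanish, and that pole is simple. -/
theorem meromorphicOrderAt_smul_of_simple_pole {E : Type*} [NormedAddCommGroup E]
    [NormedSpace ℂ E] {f : ℂ → ℂ} {g : ℂ → E} {x : ℂ} (hf : MeromorphicAt f x)
    (hfx : meromorphicOrderAt f x = -1) (hg : AnalyticAt ℂ g x) :
    (meromorphicOrderAt (fun s => f s • g s) x < 0 → g x ≠ 0) ∧
    (meromorphicOrderAt (fun s => f s • g s) x = -1 ↔ g x ≠ 0) := by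
  have hmul : meromorphicOrderAt (fun s => f s • g s) x = -1 + meromorphicOrderAt g x := by
    rw [← hfx]
    exact meromorphicOrderAt_smul hf hg.meromorphicAt
  rw [← hg.analyticOrderAt_eq_zero, hmul, hg.meromorphicOrderAt_eq]
  cases h : analyticOrderAt g x with
  -- Here `g` vanishes identically near `x`, so the product has order `⊤`: neither negative nor
  -- `-1`.
  | top =>
    have e : (⊤ : WithTop ℤ) ≠ -1 := WithTop.top_ne_coe
    simp [e]
  | coe m =>
    rw [ENat.map_natCast]
    have e : (-1 : WithTop ℤ) + (((m : ℕ) : ℤ) : WithTop ℤ) = ((-1 + (m : ℤ) : ℤ) : WithTop ℤ) := by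
      push_cast; rfl
    have e' : (-1 : WithTop ℤ) = ((-1 : ℤ) : WithTop ℤ) := rfl
    rw [e, e', WithTop.coe_inj, ← WithTop.coe_zero, WithTop.coe_lt_coe]
    simp only [Nat.cast_eq_zero]
    omega

end GeomKernel

end

/-! ### Assembly of (a), (b) and (c) -/

theorem mainTheorem7 {V : Type*} [NormedAddCommGroup V] [InnerProductSpace ℂ V]
    [FiniteDimensional ℂ V]
    -- a Fuchsian group with a fundamental domain of finite hyperbolic area
    (Γ : Subgroup GeomKernel.PSL2R) [DiscreteTopology Γ]
    (F : Set ℍ) (hF : IsFundamentalDomain Γ F (volume : Measure ℍ))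
    (hF_area : (volume : Measure ℍ) F < ⊤)
    (k : ℝ) (χ : GeomKernel.cover Γ → (V ≃ₗᵢ[ℂ] V)) (hχ : GeomKernel.IsMultiplierSystem Γ k χ) :
    -- (a) normal convergence in `(z, w; s)`, uniform convergence on compacta
    (∀ C : Set (ℍ × ℍ), IsCompact C → ∀ σ : ℝ, 1 < σ →
      (∃ M : GeomKernel.cover Γ → ℝ, Summable M ∧
        ∀ γ, ∀ p ∈ C, ∀ s : ℂ, σ ≤ s.re → ‖GeomKernel.term Γ k χ γ s p.1 p.2‖ ≤ M γ) ∧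
      HasSumUniformlyOn
        (fun γ (q : (ℍ × ℍ) × ℂ) => GeomKernel.term Γ k χ γ q.2 q.1.1 q.1.2)
        (fun q => GeomKernel.kernelSum Γ k χ q.2 q.1.1 q.1.2)
        (C ×ˢ {s : ℂ | σ ≤ s.re})) ∧
    -- (a) holomorphy of the sum in `s`
    (∀ z w : ℍ,
      DifferentiableOn ℂ (fun s => GeomKernel.kernelSum Γ k χ s z w) {s : ℂ | 1 < s.re}) ∧
    -- (b) meromorphy of the kernel in `s`, and its poles
    (∀ z w : ℍ,
      MeromorphicOn (fun s => GeomKernel.kernel Γ k χ s z w) {s : ℂ | 1 < s.re} ∧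
      (∀ s₀ : ℂ, 1 < s₀.re →
        (¬ ∃ n : ℕ, (n : ℝ) ≤ |k| - 1 ∧ s₀ = ((|k| - n : ℝ) : ℂ)) →
        AnalyticAt ℂ (fun s => GeomKernel.kernel Γ k χ s z w) s₀) ∧
      (∀ s₀ : ℂ, 1 < s₀.re →
        meromorphicOrderAt (fun s => GeomKernel.kernel Γ k χ s z w) s₀ < 0 →
        1 < |k| ∧ (∃ n : ℕ, (n : ℝ) ≤ |k| - 1 ∧ s₀ = ((|k| - n : ℝ) : ℂ)) ∧
        meromorphicOrderAt (fun s => GeomKernel.kernel Γ k χ s z w) s₀ = -1) ∧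
      (∀ n : ℕ, 1 < |k| - n →
        (meromorphicOrderAt (fun s => GeomKernel.kernel Γ k χ s z w) ((|k| - n : ℝ) : ℂ) = -1 ↔
          GeomKernel.kernelSum Γ k χ ((|k| - n : ℝ) : ℂ) z w ≠ 0))) ∧
    -- (c) the columns (images of fixed vectors) belong to `ℋ_k`
    (∀ (w : ℍ) (s : ℂ), max 1 |k| < s.re → ∀ v : V,
      GeomKernel.MemHk Γ k χ F (fun z => GeomKernel.kernel Γ k χ s z w v)) := by
  have hS : ∀ (z w : ℍ) (s₀ : ℂ), 1 < s₀.re →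
      AnalyticAt ℂ (fun s => GeomKernel.kernelSum Γ k χ s z w) s₀ := fun z w s₀ hs₀ => by
    have : CompleteSpace V := FiniteDimensional.complete ℂ V
    exact (GeomKernel.differentiableOn_kernelSum Γ k χ hF z w).analyticAt
      ((isOpen_lt continuous_const Complex.continuous_re).mem_nhds hs₀)
  refine ⟨fun C hC σ hσ => ?_, GeomKernel.differentiableOn_kernelSum Γ k χ hF,
    fun z w => ⟨fun s hs => ?_, fun s₀ hs₀ h => ?_, fun s₀ hs₀ h => ?_, fun n hn => ?_⟩,
    fun w s hs v => ?_⟩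
  · have : CompleteSpace V := FiniteDimensional.complete ℂ V
    obtain ⟨M, hM, hle⟩ := GeomKernel.exists_summable_norm_term_le Γ k χ hF hC hσ
    exact ⟨⟨M, hM, hle⟩, HasSumUniformlyOn.of_norm_le_summable hM
      fun γ q hq => hle γ q.1 hq.1 q.2 hq.2⟩
  · exact (GeomKernel.meromorphicAt_gammaFactor k hs).smul (hS z w s hs).meromorphicAt
  · exact (GeomKernel.analyticAt_gammaFactor k hs₀ h).smul (hS z w s₀ hs₀)
  · have hpole : ∃ n : ℕ, (n : ℝ) ≤ |k| - 1 ∧ s₀ = ((|k| - n : ℝ) : ℂ) := by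
      by_contra hn
      exact h.not_ge ((GeomKernel.analyticAt_gammaFactor k hs₀ hn).smul
        (hS z w s₀ hs₀)).meromorphicOrderAt_nonneg
    refine ⟨?_, hpole, ?_⟩ <;> obtain ⟨n, -, rfl⟩ := hpole <;> rw [Complex.ofReal_re] at hs₀
    · linarith [n.cast_nonneg (α := ℝ)]
    · have hs : 1 < ((|k| - n : ℝ) : ℂ).re := hs₀
      obtain ⟨h1, h2⟩ := GeomKernel.meromorphicOrderAt_smul_of_simple_pole
        (GeomKernel.meromorphicAt_gammaFactor k hs)
        (GeomKernel.meromorphicOrderAt_gammaFactor k hs₀) (hS z w _ hs)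
      exact h2.mpr (h1 h)
  · have hs : 1 < ((|k| - n : ℝ) : ℂ).re := hn
    exact (GeomKernel.meromorphicOrderAt_smul_of_simple_pole
      (GeomKernel.meromorphicAt_gammaFactor k hs)
      (GeomKernel.meromorphicOrderAt_gammaFactor k hn) (hS z w _ hs)).2
  · have hs1 : 1 < s.re := (le_max_left _ _).trans_lt hs
    refine ⟨?_, fun γ z => ?_, ?_⟩
    · have hc := GeomKernel.continuous_kernelSum_left Γ k χ hF hs1 w
      exact ((hc.clm_apply continuous_const).const_smul
        (GeomKernel.gammaFactor k s)).aestronglyMeasurable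
    · have h := GeomKernel.kernelSum_smul hχ (GeomKernel.summable_term Γ k χ hF hs1 z w) γ
      simp only [GeomKernel.kernel, h, smul_apply, ContinuousLinearMap.comp_apply,
        GeomKernel.toEnd_apply, map_smul]
      rw [smul_comm (GeomKernel.gammaFactor k s), inv_smul_smul₀ (GeomKernel.J_ne_zero k _ z)]
    -- A bounded function is square-integrable on a set of finite area.
    · obtain ⟨B, hB⟩ := GeomKernel.exists_norm_kernelSum_le Γ k χ hF hs1 w
      have hbound : ∀ z, ‖GeomKernel.kernel Γ k χ s z w v‖ₑ ^ 2 ≤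
          ENNReal.ofReal (‖GeomKernel.gammaFactor k s‖ * B * ‖v‖) ^ 2 := fun z => by
        gcongr
        rw [← ofReal_norm]
        refine ENNReal.ofReal_le_ofReal ((ContinuousLinearMap.le_opNorm _ v).trans ?_)
        rw [GeomKernel.kernel, norm_smul]
        gcongr
        exact hB z
      refine (lintegral_mono hbound).trans_lt ?_
      rw [lintegral_const, Measure.restrict_apply_univ]
      exact ENNReal.mul_lt_top (ENNReal.pow_lt_top ENNReal.ofReal_lt_top) hF_area
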